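/- **Circuit model (Thompson).** A circuit is laid out on the planar grid of unit squares; each square is empty, contains a computational node, or contains wiring of unit width (one wire joining two of its sides, or two wires crossing at a right angle). Wires join nodes, are bidirectional, and carry one bit in each direction per clock cycle. Each node has at most four wires and a constant number $m$ of bits of memory; in every clock cycle it computes a fixed function of the bits arriving on its wires, its memory, and the channel symbol injected into it in that cycle (if any). The *area* $A$ is the number of nonempty squares, $T$ is the number of clock cycles, and the *Thompson energy* is $E=AT$. An $(n,k)$-decoder is such a circuit that receives the $n$ channel output symbols, each exactly once, and puts out the $k$ decoded bits, at nodes and clock cycles fixed in advance, with at most one symbol injected into and at most one bit put out by any node in any clock cycle. A node that puts out at least one bit is an *output node*. **Decoding schemes.** A decoding scheme is an infinite sequence of decoders with block lengths $n_1<n_2<\cdots$ and numbers of decoded bits $k(n_1),k(n_2),\ldots$, together with encoding functions $\{0,1\}^{k(n_i)}\to\{0,1\}^{n_i}$; the number $m$ of memory bits per node is the same for all circuits of the scheme. The block error probability $P_{\mathrm e}(n)$ is the probability that the decoder output differs from the message, for a message of $k(n)$ independent fair bits sent through $n$ uses of a binary erasure channel with erasure probability $\epsilon$. For $f:\mathbb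 N\to\mathbb R$, the scheme is an *$f(n)$-decoding scheme* if $P_{\mathrm e}(n)<f(n)$ for all sufficiently large block lengths $n$ of the scheme. It is *serial* if the number of output nodes is the same constant for all its decoders. **Theorem.** Let $0<\epsilon\le 1$ and $f:\mathbb N\to\mathbb R$. Every serial $f(n)$-decoding scheme whose rate $k(n)/n$ is eventually bounded below by a positive constant (for example, with positive asymptotic rate) has Thompson energy $E(n)=\Omega\bigl(n\,|\ln f(n)|\bigr)$, where $|\ln f(n)|$ stands for $-\ln f(n)=\ln\frac1{f(n)}$; that is, there is a constant $c>0$ such that $$E(n)\ \ge\ c\,n\,\ln\frac{1}{f(n)}$$ for all sufficiently large block lengths $n$ of the scheme. -/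

import Mathlib

namespace Thompson

/-- The four sides of a unit grid square, also used as the four directions of travel. -/
inductive Dir
  | north
  | south
  | east
  | west
  deriving DecidableEq

instance : Fintype Dir where
  elems := {.north, .south, .east, .west}
  complete d := by cases d <;> decide

/-- The opposite side. -/
def Dir.opp : Dir → Dir
  | .north => .south
  | .south => .north
  | .east => .west
  | .west => .east

/-- The unit displacement in a given direction. -/
def Dir.vec : Dir → ℤ × ℤ
  | .north => (0, 1)
  | .south => (0, -1)
  | .east => (1, 0)
  | .west => (-1, 0)

/-- What a wiring square holds: one wire (straight or bent) that joins two distinct sides, or two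
wires that cross at a right angle. -/
inductive Track
  | wire (p q : Dir) (h : p ≠ q)
  | crossing

/-- A signal travelling in direction `d` enters a square by its side `d.opp`; `thru` is the direction
in which the wire carries it out of the square (`none` if no wire starts at the side of entry). -/
def Track.thru : Track → Dir → Option Dir
  | .wire p q _, d => if d.opp = p then some q else if d.opp = q then some p else none
  | .crossing, d => some d

/-- A circuit layout on the planar grid of unit squares. Every square is empty, holds one
computational node, or holds wiring; wires have unit width. The values of `track` outside of
`wires` are irrelevant. -/
structure Layout where
  nodes : Finset (ℤ × ℤ)
  wires : Finset (ℤ × ℤ)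
  disj : Disjoint nodes wires
  track : ℤ × ℤ → Track

namespace Layout

/-- The computational nodes of a layout. -/
abbrev Node (L : Layout) : Type := {s : ℤ × ℤ // s ∈ L.nodes}

/-- The area occupied by the circuit: the number of nonempty unit squares. -/
def area (L : Layout) : ℕ := L.nodes.card + L.wires.card

/-- Leave the square `s` in direction `d` and follow the wire, for at most `fuel` squares, up to the
node at its other end; the result is that node and the port (side) at which the wire arrives. -/
def trace (L : Layout) : ℕ → ℤ × ℤ → Dir → Option (L.Node × Dir)
  | 0, _, _ => none
  | fuel + 1, s, d =>
    if h : s + d.vec ∈ L.nodes then some (⟨s + d.vec, h⟩, d.opp)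
    else if s + d.vec ∈ L.wires then
      match (L.track (s + d.vec)).thru d with
      | none => none
      | some d' => L.trace fuel (s + d.vec) d'
    else none

/-- The node and port at the other end of the wire attached to port `d` of the node `v`, if there is
one. A wire visits no pair (square, direction) twice, so the bound `4 * area + 1` on its length is
no restriction. -/
def peer (L : Layout) (v : L.Node) (d : Dir) : Option (L.Node × Dir) :=
  L.trace (4 * L.area + 1) v.1 d

end Layout

/-- The alphabet at the output of the binary erasure channel; `none` is an erasure. -/
abbrev Symbol : Type := Option Bool

/-- The function computed by a node with `m` bits of memory in one clock cycle. Arguments: the bits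
arriving on its (at most four) wires, its memory, and the channel symbol injected in this cycle
(`none` if there is none). Values: the bits sent on its wires, the new memory, and the bit put out,
which counts only at an output node in a cycle in which it is scheduled to put out a bit. -/
abbrev NodeOp (m : ℕ) : Type :=
  (Dir → Bool) → (Fin m → Bool) → Option Symbol → (Dir → Bool) × (Fin m → Bool) × Bool

/-- A synchronous circuit in the Thompson model, with `n` input symbols and `k` output bits, run for
`T` clock cycles. Wires are bidirectional and carry one bit in each direction per cycle, and each
node has `m` bits of memory. Each input is injected exactly once and each output bit is put out at a
specified node and cycle, at most one input and at most one output per node and cycle. -/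
structure Circuit (m n k : ℕ) extends Layout where
  /-- number of clock cycles -/
  T : ℕ
  op : toLayout.Node → NodeOp m
  /-- initial bits on the wires and in the memories -/
  init : toLayout.Node → (Dir → Bool) × (Fin m → Bool)
  inNode : Fin n → toLayout.Node
  inTime : Fin n → Fin T
  in_inj : Function.Injective fun a => (inNode a, inTime a)
  outNode : Fin k → toLayout.Node
  outTime : Fin k → Fin T
  out_inj : Function.Injective fun b => (outNode b, outTime b)

namespace Circuit

variable {m n k : ℕ}

/-- The state of a circuit between two cycles: for each node the bits it has last sent on its wires,
and the content of its memory. -/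
abbrev State (C : Circuit m n k) : Type := C.Node → (Dir → Bool) × (Fin m → Bool)

/-- The bit arriving at port `d` of node `v`; it is `0` if no node is attached there. -/
def incoming (C : Circuit m n k) (σ : C.State) (v : C.Node) (d : Dir) : Bool :=
  match C.peer v d with
  | none => false
  | some (w, e) => (σ w).1 e

/-- The symbol of `y` injected into node `v` in cycle `t`, if any. -/
def injected (C : Circuit m n k) (y : Fin n → Symbol) (v : C.Node) (t : ℕ) : Option Symbol :=
  ((List.finRange n).find? fun a => C.inNode a = v ∧ (C.inTime a : ℕ) = t).map y

/-- What node `v` computes in cycle `t` from the state `σ`. -/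
def fire (C : Circuit m n k) (y : Fin n → Symbol) (σ : C.State) (t : ℕ) (v : C.Node) :
    (Dir → Bool) × (Fin m → Bool) × Bool :=
  C.op v (C.incoming σ v) (σ v).2 (C.injected y v t)

/-- The state after `t` cycles on input `y`. -/
def stateAt (C : Circuit m n k) (y : Fin n → Symbol) : ℕ → C.State
  | 0 => C.init
  | t + 1 => fun v =>
    ((C.fire y (C.stateAt y t) t v).1, (C.fire y (C.stateAt y t) t v).2.1)

/-- The decoding function computed by the circuit. -/
def decode (C : Circuit m n k) (y : Fin n → Symbol) : Fin k → Bool := fun b =>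
  (C.fire y (C.stateAt y (C.outTime b)) (C.outTime b) (C.outNode b)).2.2

/-- The number of output nodes: nodes that put out at least one bit. -/
def numOutputNodes (C : Circuit m n k) : ℕ := (Finset.univ.image C.outNode).card

/-- The Thompson energy: area times number of clock cycles. -/
def energy (C : Circuit m n k) : ℕ := C.area * C.T

end Circuit

/-- Transition probabilities of the binary erasure channel with erasure probability `ε`. -/
noncomputable def bec (ε : ℝ) (b : Bool) : Symbol → ℝ
  | none => ε
  | some b' => if b' = b then 1 - ε else 0

/-- The probability that a uniformly distributed `k`-bit message, encoded by `enc` and sent through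
`n` independent uses of the erasure channel, is decoded incorrectly by `dec`. -/
noncomputable def blockErrorProb (ε : ℝ) {n k : ℕ} (enc : (Fin k → Bool) → (Fin n → Bool))
    (dec : (Fin n → Symbol) → (Fin k → Bool)) : ℝ :=
  ∑ x : Fin k → Bool, (1 / 2 : ℝ) ^ k *
    ∑ y : Fin n → Symbol, (∏ a, bec ε (enc x a) (y a)) * if dec y = x then 0 else 1

/-- A decoding scheme: a sequence of codes with strictly increasing block lengths together with
decoder circuits, whose nodes all have `m` bits of memory. -/
structure DecodingScheme (m : ℕ) where
  /-- block lengths -/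
  n : ℕ → ℕ
  n_strictMono : StrictMono n
  /-- numbers of bits decoded -/
  k : ℕ → ℕ
  enc : ∀ i, (Fin (k i) → Bool) → (Fin (n i) → Bool)
  dec : ∀ i, Circuit m (n i) (k i)

namespace DecodingScheme

variable {m : ℕ}

/-- The block error probability of the `i`-th decoder over the erasure channel. -/
noncomputable def errorProb (S : DecodingScheme m) (ε : ℝ) (i : ℕ) : ℝ :=
  blockErrorProb ε (S.enc i) (S.dec i).decode

/-- The block error probability is less than `f n` at all sufficiently large block lengths `n`. -/
def IsFDecoding (S : DecodingScheme m) (ε : ℝ) (f : ℕ → ℝ) : Prop :=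
  ∀ᶠ i in Filter.atTop, S.errorProb ε i < f (S.n i)

/-- Serial: the number of output nodes is constant. -/
def IsSerial (S : DecodingScheme m) : Prop :=
  ∃ j : ℕ, ∀ i, (S.dec i).numOutputNodes = j

/-- The rate `k / n` is eventually bounded below by a positive constant; this holds in particular
whenever the rate converges to a positive limit. -/
def HasPositiveRate (S : DecodingScheme m) : Prop :=
  ∃ ρ : ℝ, 0 < ρ ∧ ∀ᶠ i in Filter.atTop, ρ * (S.n i : ℝ) ≤ (S.k i : ℝ)

end DecodingScheme

end Thompson

namespace Thompson

open Finset

/-! The energy bound is a product of two bounds. A constant number of output nodes puts out `k` bits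
only in a time `T` of order `k`, hence of order `n` at positive rate. The area is at least of order
`-log f`, for any number of output nodes.

For the area, consider a window of cycles in which more bits are put out than the whole circuit can
store. If every symbol injected during the window is erased, those bits depend only on the state at
its start, so they take at most half of their possible values and decoding fails with probability at
least 1/2. By averaging (`exists_window`), some such window receives only `d = O(area * n / k)`
symbols, so the error probability is at least `ε ^ d / 2` (`half_mul_pow_le_of_window`,
`exists_half_mul_pow_le`). Taking logarithms gives `neg_log_le_area`. -/

/-- If the per-step increments of `O` are at most `J`, some window in which `O` grows by at least
`M` contains at most about its fair share of the growth of the monotone function `I`. -/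
lemma exists_window (O I : ℕ → ℕ) (J M T : ℕ) (hM : 0 < M) (hO0 : O 0 = 0)
    (hO : ∀ t, O (t + 1) ≤ O t + J) (hI : Monotone I) (hT : M + J ≤ O T) :
    ∃ s t, s ≤ t ∧ O s + M ≤ O t ∧ (I t - I s) * O T ≤ 2 * (M + J) * I T := by
  by_contra! hcon
  -- If every window is expensive, costs add up over `q` disjoint windows. The `+ 1` records
  -- strictness, which is needed when `I T = 0`.
  have claim : ∀ q t, q * (M + J) ≤ O t → q * (2 * (M + J) * I T + 1) ≤ I t * O T := by
    intro q
    induction q with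
    | zero => intro t _; simp
    | succ q ih =>
      intro t ht
      have hex : ∃ s, q * (M + J) ≤ O s := ⟨t, by nlinarith⟩
      classical
      set s := Nat.find hex with hs
      have hs1 : q * (M + J) ≤ O s := Nat.find_spec hex
      have hst : s ≤ t := Nat.find_min' hex (by nlinarith)
      -- By minimality of `s`, the level is overshot by at most `J`, so at least `M` of the next `M
      -- + J` units of growth remain for the window from `s` to `t`.
      have hs2 : O s ≤ q * (M + J) + J := by
        rcases Nat.eq_zero_or_eq_succ_pred s with h0 | h0
        · rw [h0, hO0]; exact Nat.zero_le _
        · have hlt : ¬ q * (M + J) ≤ O (s.pred) := Nat.find_min hex (by omega)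
          have := hO s.pred
          rw [← Nat.succ_eq_add_one, ← h0] at this
          omega
      have h1 := hcon s t hst (by linarith [add_mul q 1 (M + J)])
      have h2 := ih s hs1
      have h3 : I t * O T = I s * O T + (I t - I s) * O T := by
        rw [← add_mul, Nat.add_sub_cancel' (hI hst)]
      rw [h3, add_mul]
      linarith
  have hB : 0 < M + J := by omega
  have hq : 1 ≤ O T / (M + J) := (Nat.one_le_div_iff hB).2 hT
  have h1 := claim _ T (Nat.div_mul_le_self (O T) (M + J))
  have h2 := Nat.lt_div_mul_add (a := O T) hB
  generalize O T / (M + J) = q at *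
  -- Rounding down to `q ≥ 1` whole windows loses at most a factor 2, the one in the statement.
  have h3 : O T ≤ 2 * (q * (M + J)) := by nlinarith
  have h4 := Nat.mul_le_mul_left (I T) h3
  nlinarith

/-! ### Erasures and the block error probability -/

section ErrorProbability

variable {n k : ℕ}

lemma bec_nonneg {ε : ℝ} (h0 : 0 ≤ ε) (h1 : ε ≤ 1) (b : Bool) (s : Symbol) : 0 ≤ bec ε b s := by
  cases s with
  | none => exact h0
  | some b' =>
    simp only [bec]
    split_ifs <;> linarith

lemma sum_bec (ε : ℝ) (b : Bool) : ∑ s, bec ε b s = 1 := by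
  rw [Fintype.sum_option]
  cases b <;> simp [bec]

/-- The probability that the symbols in `D` are all erased is `ε ^ #D`. -/
lemma sum_prod_bec_erased (ε : ℝ) (D : Finset (Fin n)) (c : Fin n → Bool) :
    ∑ y ∈ Fintype.piFinset (fun a => if a ∈ D then {none} else univ),
      ∏ a, bec ε (c a) (y a) = ε ^ #D := by
  rw [← Finset.prod_univ_sum]
  have : ∀ a, ∑ s ∈ (if a ∈ D then {none} else univ), bec ε (c a) s = if a ∈ D then ε else 1 := by
    intro a
    split_ifs
    · simp [bec]
    · exact sum_bec ε (c a)
  simp [this]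

/-- If the bits decoded at `W` take few values when the symbols in `D` are erased, then the block
error probability is at least half the probability of that erasure. -/
lemma half_mul_pow_le_blockErrorProb {ε : ℝ} (h0 : 0 ≤ ε) (h1 : ε ≤ 1)
    (enc : (Fin k → Bool) → (Fin n → Bool)) (dec : (Fin n → Symbol) → (Fin k → Bool))
    (D : Finset (Fin n)) (W : Finset (Fin k)) (G : Finset (W → Bool)) (hG : 2 * #G ≤ 2 ^ #W)
    (hdec : ∀ y, (∀ a ∈ D, y a = none) → (fun b : W => dec y b) ∈ G) :
    1 / 2 * ε ^ #D ≤ blockErrorProb ε enc dec := by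
  classical
  -- Only these messages can be decoded correctly when `D` is erased; they are at most half of all
  -- messages.
  set good : Finset (Fin k → Bool) := univ.filter fun x => (fun b : W => x b) ∈ G with hgood
  have hgoodcard : 2 * #good ≤ 2 ^ k := by
    have hinj : #good ≤ #(G ×ˢ (univ : Finset ({b // b ∉ W} → Bool))) := by
      refine Finset.card_le_card_of_injOn (fun x => (fun b : W => x b, fun b => x b)) ?_ ?_
      · intro x hx
        simpa [hgood] using hx
      · intro x _ x' _ hxx
        funext b
        by_cases hb : b ∈ W
        · exact congrFun (Prod.ext_iff.1 hxx).1 ⟨b, hb⟩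
        · exact congrFun (Prod.ext_iff.1 hxx).2 ⟨b, hb⟩
    have hle : #W ≤ k := by simpa using Finset.card_le_univ W
    have hc : Fintype.card {b // b ∉ W} = k - #W := by
      simp [Fintype.card_subtype_compl]
    rw [Finset.card_product, Finset.card_univ, Fintype.card_fun, hc, Fintype.card_bool] at hinj
    calc 2 * #good ≤ (2 * #G) * 2 ^ (k - #W) := by rw [mul_assoc]; exact Nat.mul_le_mul_left 2 hinj
      _ ≤ 2 ^ #W * 2 ^ (k - #W) := Nat.mul_le_mul_right _ hG
      _ = 2 ^ k := by rw [← pow_add, Nat.add_sub_cancel' hle]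
  have hbad : (2 : ℝ) ^ k ≤ 2 * #goodᶜ := by
    have : #good + #goodᶜ = 2 ^ k := by simp [Finset.card_add_card_compl]
    have h2 : 2 ^ k ≤ 2 * #goodᶜ := by omega
    exact_mod_cast h2
  have hP : ∀ x (y : Fin n → Symbol), 0 ≤ ∏ a, bec ε (enc x a) (y a) := fun x y =>
    Finset.prod_nonneg fun a _ => bec_nonneg h0 h1 _ _
  have hterm : ∀ x (y : Fin n → Symbol), 0 ≤ (∏ a, bec ε (enc x a) (y a)) * if dec y = x then (0 : ℝ) else 1 :=
    fun x y => mul_nonneg (hP x y) (by split_ifs <;> norm_num)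
  have hinner : ∀ x ∈ goodᶜ, ε ^ #D ≤
      ∑ y : Fin n → Symbol, (∏ a, bec ε (enc x a) (y a)) * if dec y = x then 0 else 1 := by
    intro x hx
    rw [← sum_prod_bec_erased ε D (enc x)]
    calc _ = ∑ y ∈ Fintype.piFinset (fun a => if a ∈ D then {none} else univ),
          (∏ a, bec ε (enc x a) (y a)) * if dec y = x then 0 else 1 := by
          refine Finset.sum_congr rfl fun y hy => ?_
          rw [if_neg, mul_one]
          rintro rfl
          simp only [hgood, Finset.mem_compl, Finset.mem_filter, Finset.mem_univ, true_and] at hx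
          refine hx (hdec y fun a ha => ?_)
          have := Fintype.mem_piFinset.1 hy a
          simpa [ha] using this
      _ ≤ _ := Finset.sum_le_sum_of_subset_of_nonneg (Finset.subset_univ _)
          fun y _ _ => hterm x y
  have hpow : (1 / 2 : ℝ) ^ k * 2 ^ k = 1 := by rw [← mul_pow]; norm_num
  calc 1 / 2 * ε ^ #D = (1 / 2 : ℝ) ^ k * (2 ^ k / 2) * ε ^ #D := by
        rw [← mul_div_assoc, hpow]
    _ ≤ (1 / 2 : ℝ) ^ k * #goodᶜ * ε ^ #D := by gcongr; linarith
    _ = ∑ x ∈ goodᶜ, (1 / 2 : ℝ) ^ k * ε ^ #D := by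
        rw [Finset.sum_const, nsmul_eq_mul]; ring
    _ ≤ ∑ x ∈ goodᶜ, (1 / 2 : ℝ) ^ k *
          ∑ y : Fin n → Symbol, (∏ a, bec ε (enc x a) (y a)) * if dec y = x then 0 else 1 :=
        Finset.sum_le_sum fun x hx => mul_le_mul_of_nonneg_left (hinner x hx) (by positivity)
    _ ≤ blockErrorProb ε enc dec :=
        Finset.sum_le_sum_of_subset_of_nonneg (Finset.subset_univ _) fun x _ _ =>
          mul_nonneg (by positivity) (Finset.sum_nonneg fun y _ => hterm x y)

end ErrorProbability

/-! ### Information flow through a circuit -/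

namespace Circuit

variable {m n k : ℕ}

lemma injected_congr (C : Circuit m n k) {y y' : Fin n → Symbol} {t : ℕ}
    (h : ∀ a, (C.inTime a : ℕ) = t → y a = y' a) (v : C.Node) :
    C.injected y v t = C.injected y' v t := by
  unfold injected
  cases hf : (List.finRange n).find? fun a => C.inNode a = v ∧ (C.inTime a : ℕ) = t with
  | none => rfl
  | some a =>
    have := List.find?_some hf
    simp only [Bool.decide_and, Bool.and_eq_true, decide_eq_true_eq] at this
    simp [h a this.2]

/-- Causality: the past acts on a window of cycles only through the state at its start. -/
lemma stateAt_congr (C : Circuit m n k) {y y' : Fin n → Symbol} {s t : ℕ} (hst : s ≤ t)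
    (h : ∀ a, s ≤ C.inTime a → (C.inTime a : ℕ) < t → y a = y' a)
    (hs : C.stateAt y s = C.stateAt y' s) : C.stateAt y t = C.stateAt y' t := by
  induction t, hst using Nat.le_induction with
  | base => exact hs
  | succ t hst ih =>
    have h1 := ih fun a h2 h3 => h a h2 (h3.trans t.lt_succ_self)
    funext v
    simp only [stateAt, fire, h1,
      C.injected_congr (fun a (ha : _ = t) => h a (ha ▸ hst) (by omega)) v]

lemma decode_congr (C : Circuit m n k) {y y' : Fin n → Symbol} {s t : ℕ}
    (h : ∀ a, s ≤ C.inTime a → (C.inTime a : ℕ) < t → y a = y' a)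
    (hs : C.stateAt y s = C.stateAt y' s) (b : Fin k) (hb : s ≤ C.outTime b)
    (hb' : (C.outTime b : ℕ) < t) : C.decode y b = C.decode y' b := by
  have h1 := C.stateAt_congr hb (fun a h2 h3 => h a h2 (h3.trans hb')) hs
  simp only [decode, fire, h1, C.injected_congr
    (fun a (ha : _ = (C.outTime b : ℕ)) => h a (ha ▸ hb) (ha ▸ hb')) (C.outNode b)]

lemma card_state (C : Circuit m n k) : Fintype.card C.State = 2 ^ ((4 + m) * #C.nodes) := by
  have h4 : Fintype.card Dir = 4 := rfl
  simp only [State, Layout.Node, Fintype.card_fun, Fintype.card_prod, Fintype.card_bool,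
    Fintype.card_fin, h4, Fintype.card_coe]
  rw [← pow_add, ← pow_mul]

/-- The number of outputs produced before cycle `t`. -/
def outputsBefore (C : Circuit m n k) (t : ℕ) : ℕ := #{b | (C.outTime b : ℕ) < t}

/-- The number of inputs injected before cycle `t`. -/
def inputsBefore (C : Circuit m n k) (t : ℕ) : ℕ := #{a | (C.inTime a : ℕ) < t}

lemma card_outputs_at_le (C : Circuit m n k) (t : ℕ) :
    #{b | (C.outTime b : ℕ) = t} ≤ C.numOutputNodes := by
  refine Finset.card_le_card_of_injOn C.outNode (fun b _ => by simp) ?_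
  intro b hb b' hb' h
  simp only [Finset.coe_filter, Finset.mem_univ, true_and, Set.mem_ofPred_eq] at hb hb'
  exact C.out_inj (Prod.ext h (Fin.ext (hb.trans hb'.symm)))

lemma numOutputNodes_le_card_nodes (C : Circuit m n k) : C.numOutputNodes ≤ #C.nodes := by
  simpa [numOutputNodes] using Finset.card_le_univ (univ.image C.outNode)

/-- Counting all nodes instead of the output nodes suffices here, since the number of nodes is
itself bounded by the area. -/
lemma outputsBefore_succ_le (C : Circuit m n k) (t : ℕ) :
    C.outputsBefore (t + 1) ≤ C.outputsBefore t + #C.nodes := by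
  refine le_trans ?_ (Nat.add_le_add_left
    ((C.card_outputs_at_le t).trans C.numOutputNodes_le_card_nodes) _)
  refine le_trans (Finset.card_le_card fun b hb => ?_) (Finset.card_union_le _ _)
  simp only [Finset.mem_filter, Finset.mem_univ, true_and, Finset.mem_union] at hb ⊢
  omega

lemma outputsBefore_T (C : Circuit m n k) : C.outputsBefore C.T = k := by
  simp [outputsBefore]

lemma inputsBefore_T (C : Circuit m n k) : C.inputsBefore C.T = n := by
  simp [inputsBefore]

lemma inputsBefore_mono (C : Circuit m n k) : Monotone C.inputsBefore := fun s t h =>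
  Finset.card_le_card fun a ha => by
    simp only [Finset.mem_filter, Finset.mem_univ, true_and] at ha ⊢
    omega

lemma le_numOutputNodes_mul_T (C : Circuit m n k) : k ≤ C.numOutputNodes * C.T := by
  have h := Finset.card_le_card_of_injOn (s := (univ : Finset (Fin k)))
    (t := univ.image C.outNode ×ˢ (univ : Finset (Fin C.T)))
    (fun b => (C.outNode b, C.outTime b)) (fun b _ => by simp) C.out_inj.injOn
  simpa [numOutputNodes] using h

/-- Erasing all symbols that enter during a window of cycles leaves only the state at its beginning
to determine the bits put out during the window. -/
lemma half_mul_pow_le_of_window (C : Circuit m n k) {ε : ℝ} (h0 : 0 ≤ ε) (h1 : ε ≤ 1)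
    (enc : (Fin k → Bool) → (Fin n → Bool)) {s t : ℕ} (hst : s ≤ t) {N : ℕ}
    (S : Finset C.State) (hS : ∀ y, C.stateAt y s ∈ S) (hN : #S ≤ 2 ^ N)
    (hW : C.outputsBefore s + (N + 1) ≤ C.outputsBefore t) :
    1 / 2 * ε ^ (C.inputsBefore t - C.inputsBefore s) ≤ blockErrorProb ε enc C.decode := by
  classical
  set D : Finset (Fin n) := {a | s ≤ C.inTime a ∧ (C.inTime a : ℕ) < t} with hD
  set W : Finset (Fin k) := {b | s ≤ C.outTime b ∧ (C.outTime b : ℕ) < t} with hWdef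
  have hDcard : #D = C.inputsBefore t - C.inputsBefore s := by
    unfold inputsBefore
    rw [← Finset.card_sdiff_of_subset]
    · congr 1
      ext a
      simp only [hD, Finset.mem_filter, Finset.mem_univ, true_and, Finset.mem_sdiff]
      omega
    · intro a
      simp only [Finset.mem_filter, Finset.mem_univ, true_and]
      omega
  have hWcard : N + 1 ≤ #W := by
    have : C.outputsBefore t ≤ C.outputsBefore s + #W := by
      refine le_trans (Finset.card_le_card fun b hb => ?_) (Finset.card_union_le _ _)
      simp only [hWdef, Finset.mem_filter, Finset.mem_univ, true_and, Finset.mem_union] at hb ⊢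
      omega
    omega
  set E : Finset (Fin n → Symbol) := univ.filter fun y => ∀ a ∈ D, y a = none with hE
  set r : (Fin n → Symbol) → (W → Bool) := fun y b => C.decode y b with hr
  -- Each value of the window's outputs is assigned a state at cycle `s` that produces it; by
  -- causality no state serves two values.
  have hG : #(E.image r) ≤ #S := by
    refine Finset.card_le_card_of_forall_subsingleton
      (fun g σ => ∃ y ∈ E, r y = g ∧ C.stateAt y s = σ) ?_ ?_
    · intro g hg
      obtain ⟨y, hy, rfl⟩ := Finset.mem_image.1 hg
      exact ⟨_, hS y, y, hy, rfl, rfl⟩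
    · rintro σ _ g ⟨_, y, hy, rfl, hσ⟩ g' ⟨_, y', hy', rfl, hσ'⟩
      funext b
      have hb := b.2
      simp only [hWdef, Finset.mem_filter, Finset.mem_univ, true_and] at hb
      simp only [hE, hD, Finset.mem_filter, Finset.mem_univ, true_and] at hy hy'
      exact C.decode_congr (fun a h2 h3 => by rw [hy a ⟨h2, h3⟩, hy' a ⟨h2, h3⟩])
        (hσ.trans hσ'.symm) b hb.1 hb.2
  rw [← hDcard]
  refine half_mul_pow_le_blockErrorProb h0 h1 enc C.decode D W (E.image r) ?_ ?_
  · calc 2 * #(E.image r) ≤ 2 * 2 ^ N := Nat.mul_le_mul_left 2 (hG.trans hN)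
      _ = 2 ^ (N + 1) := by ring
      _ ≤ 2 ^ #W := Nat.pow_le_pow_right (by norm_num) hWcard
  · intro y hy
    exact Finset.mem_image.2 ⟨y, by simpa [hE] using hy, rfl⟩

/-- The block error probability is at least half the probability of `d` erasures, where `d` is at
most proportional to the area divided by the rate. -/
lemma exists_half_mul_pow_le (C : Circuit m n k) (hk : 0 < k) {ε : ℝ} (h0 : 0 ≤ ε) (h1 : ε ≤ 1)
    (enc : (Fin k → Bool) → (Fin n → Bool)) :
    ∃ d : ℕ, d * k ≤ 2 * ((6 + m) * C.area) * n ∧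
      1 / 2 * ε ^ d ≤ blockErrorProb ε enc C.decode := by
  have hnodes : 0 < #C.nodes := Finset.card_pos.2 ⟨_, (C.outNode ⟨0, hk⟩).2⟩
  have harea : #C.nodes ≤ C.area := Nat.le_add_right _ _
  -- The left side is window growth plus overshoot, `M + J`; the lone `1` is absorbed because there
  -- is at least one node.
  have hB : (4 + m) * #C.nodes + 1 + #C.nodes ≤ (6 + m) * C.area := by nlinarith
  have hO0 : C.outputsBefore 0 = 0 := by simp [outputsBefore]
  have hI0 : C.inputsBefore 0 = 0 := by simp [inputsBefore]
  by_cases hlarge : (4 + m) * #C.nodes + 1 + #C.nodes ≤ k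
  · obtain ⟨s, t, hst, hs, hd⟩ := exists_window C.outputsBefore C.inputsBefore #C.nodes
      ((4 + m) * #C.nodes + 1) C.T (Nat.succ_pos _) hO0 C.outputsBefore_succ_le
      C.inputsBefore_mono (by rwa [C.outputsBefore_T])
    rw [C.outputsBefore_T, C.inputsBefore_T] at hd
    refine ⟨_, hd.trans (by gcongr), ?_⟩
    exact C.half_mul_pow_le_of_window h0 h1 enc hst univ (fun _ => Finset.mem_univ _)
      (by rw [Finset.card_univ, C.card_state]) hs
  -- With too few outputs to exceed the storage, the whole run is the window. Its starting state is
  -- the fixed `C.init`, so `N = 0` and a single output bit suffices.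
  · refine ⟨n, ?_, ?_⟩
    · rw [mul_comm]
      exact Nat.mul_le_mul_right n (by omega)
    · have := C.half_mul_pow_le_of_window h0 h1 enc (Nat.zero_le C.T) (N := 0) {C.init}
        (fun y => by simp [stateAt]) (by simp) (by rw [hO0, C.outputsBefore_T]; omega)
      rwa [hI0, C.inputsBefore_T, Nat.sub_zero] at this

end Circuit

/-! ### Area and energy bounds -/

/-- The area needed for a given reliability, at rate at least `ρ`. -/
lemma Circuit.neg_log_le_area {m n k : ℕ} (C : Circuit m n k) {ε ρ p : ℝ} (hn : 0 < n)
    (h0 : 0 < ε) (h1 : ε ≤ 1) (hρ : 0 < ρ) (hk : ρ * n ≤ k)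
    (enc : (Fin k → Bool) → (Fin n → Bool)) (hp : blockErrorProb ε enc C.decode < p) :
    -Real.log p ≤ (Real.log 2 + 2 * (6 + m) / ρ * -Real.log ε) * C.area := by
  have hn' : (0 : ℝ) < n := by exact_mod_cast hn
  have hkpos : (0 : ℝ) < k := lt_of_lt_of_le (by positivity) hk
  have hk0 : 0 < k := by exact_mod_cast hkpos
  obtain ⟨d, hd, hP⟩ := C.exists_half_mul_pow_le hk0 h0.le h1 enc
  have hlog := Real.log_le_log (by positivity) (hP.trans hp.le)
  rw [Real.log_mul (by norm_num) (by positivity), Real.log_pow, one_div, Real.log_inv] at hlog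
  have hL : 0 ≤ -Real.log ε := by linarith [Real.log_nonpos h0.le h1]
  have hA : (1 : ℝ) ≤ C.area := by
    have : 0 < #C.nodes := Finset.card_pos.2 ⟨_, (C.outNode ⟨0, hk0⟩).2⟩
    exact_mod_cast this.trans_le (Nat.le_add_right _ _)
  have hdle : (d : ℝ) ≤ 2 * (6 + m) / ρ * C.area := by
    have hd' : (d : ℝ) * k ≤ 2 * ((6 + m) * C.area) * n := by exact_mod_cast hd
    have h2 : (d : ℝ) * (ρ * n) ≤ d * k := by gcongr
    have h3 : (d * ρ : ℝ) * n ≤ (2 * ((6 + m) * C.area)) * n := by linarith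
    rw [div_mul_eq_mul_div, le_div_iff₀ hρ]
    linarith [le_of_mul_le_mul_right h3 hn']
  have h4 := mul_le_mul_of_nonneg_right hdle hL
  -- The loss `log 2` from the factor 1/2 is absorbed into the area, which is at least 1.
  have h5 : Real.log 2 * 1 ≤ Real.log 2 * C.area :=
    mul_le_mul_of_nonneg_left hA (Real.log_nonneg one_le_two)
  linarith

end Thompson

theorem mainTheorem6 (m : ℕ) (ε : ℝ) (hε0 : 0 < ε) (hε1 : ε ≤ 1) (f : ℕ → ℝ)
    (S : Thompson.DecodingScheme m) (hrate : S.HasPositiveRate) (hserial : S.IsSerial)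
    (hf : S.IsFDecoding ε f) :
    ∃ c : ℝ, 0 < c ∧ ∀ᶠ i in Filter.atTop,
      c * ((S.n i : ℝ) * (-Real.log (f (S.n i)))) ≤ ((S.dec i).energy : ℝ) := by
  obtain ⟨ρ, hρ, hrate⟩ := hrate
  obtain ⟨j, hj⟩ := hserial
  set K : ℝ := Real.log 2 + 2 * (6 + m) / ρ * -Real.log ε with hK
  have hL : 0 ≤ -Real.log ε := by linarith [Real.log_nonpos hε0.le hε1]
  have hKpos : 0 < K := add_pos_of_pos_of_nonneg (Real.log_pos one_lt_two) (by positivity)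
  -- The factor `ρ / (j + 1)` comes from the time bound and `1 / K` from the area bound; `j + 1`
  -- replaces `j` to keep the denominator positive without a case split.
  refine ⟨ρ / ((j + 1) * K), by positivity, ?_⟩
  filter_upwards [hrate, hf, Filter.eventually_ge_atTop 1] with i hk hp hi
  have hn : 0 < S.n i := hi.trans (S.n_strictMono.id_le i)
  have harea := (S.dec i).neg_log_le_area hn hε0 hε1 hρ hk (S.enc i) hp
  have hkT : (S.k i : ℝ) ≤ j * (S.dec i).T := by
    exact_mod_cast hj i ▸ (S.dec i).le_numOutputNodes_mul_T
  have hT : ρ * S.n i ≤ (j + 1) * (S.dec i).T := by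
    linarith [Nat.cast_nonneg (α := ℝ) (S.dec i).T]
  rw [div_mul_eq_mul_div, div_le_iff₀ (by positivity), Thompson.Circuit.energy, Nat.cast_mul]
  calc ρ * (S.n i * -Real.log (f (S.n i))) = (ρ * S.n i) * -Real.log (f (S.n i)) := by ring
    _ ≤ (ρ * S.n i) * (K * (S.dec i).area) := mul_le_mul_of_nonneg_left harea (by positivity)
    _ ≤ ((j + 1) * (S.dec i).T) * (K * (S.dec i).area) :=
        mul_le_mul_of_nonneg_right hT (by positivity)
    _ = _ := by ring
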